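/- Let $\mathbb T=\{z\in\mathbb C:|z|=1\}$ with normalized Haar measure, let $e_0\in L^2(\mathbb T)$ be the constant function $1$, and let $$m_0(z)=\frac{1+z^2}{\sqrt2},\qquad m_1(z)=z,\qquad m_2(z)=\frac{1-z^2}{\sqrt2}\qquad(z\in\mathbb T).$$ Then: (1) For every $z\in\mathbb T$ the $3\times3$ matrix $M_3(z)=\frac1{\sqrt3}\bigl(m_j(ze^{2\pi ik/3})\bigr)_{j,k=0}^{2}$ is unitary. (2) The bounded operators $(S_if)(z)=m_i(z)f(z^3)$, $i=0,1,2$, on $L^2(\mathbb T)$ define a representation of the Cuntz algebra $\mathcal O_3$, i.e. they satisfy the Cuntz relations $S_i^*S_j=\delta_{i,j}I$ and $\sum_{i=0}^2S_iS_i^*=I$. (3) Let $s=\ln 2/\ln 3=\log_32$, let $X_3\subset[0,1]$ be the middle-third Cantor set, and let $\mathcal H^s$ be the $s$-dimensional Hausdorff measure on $\mathbb R$ normalized so that $\mathcal H^s(A)=\lim_{\delta\to0}\inf\sum_n(\operatorname{diam}A_n)^s$, the infimum over countable covers $(A_n)$ of $A$ by sets of diameter at most $\delta$. There is exactly one Borel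 probability measure $\mu_0$ on $[0,1]$ such that $$\mu_0\Bigl(\bigl[\tfrac{i_1}{3}+\dots+\tfrac{i_k}{3^k},\ \tfrac{i_1}{3}+\dots+\tfrac{i_k}{3^k}+\tfrac1{3^k}\bigr)\Bigr)=\|S_{i_k}^*\cdots S_{i_2}^*S_{i_1}^*e_0\|^2$$ for all $k\ge0$ and $i_1,\dots,i_k\in\{0,1,2\}$, and it is the restriction of $\mathcal H^s$ to $X_3$, that is, $\mu_0(B)=\mathcal H^s(B\cap X_3)$ for all Borel sets $B$; in particular $\mathcal H^s(X_3)=1$. -/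

import Mathlib

open MeasureTheory

noncomputable section

/-- The circle `𝕋 = {z ∈ ℂ : |z| = 1}` carries its Borel σ-algebra. -/
instance circleMeasurableSpace : MeasurableSpace Circle := borel Circle

instance circleBorelSpace : BorelSpace Circle := ⟨rfl⟩

/-- The normalized Haar measure on `𝕋` (total mass one). -/
def circleHaar : Measure Circle := Measure.haarMeasure ⊤

instance circleHaar_isHaarMeasure : circleHaar.IsHaarMeasure :=
  inferInstanceAs (Measure.haarMeasure ⊤).IsHaarMeasure

instance circleHaar_isProbabilityMeasure : IsProbabilityMeasure circleHaar :=
  ⟨by simpa [circleHaar] using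
    (Measure.haarMeasure_self (K₀ := (⊤ : TopologicalSpace.PositiveCompacts Circle)))⟩

/-- The complex Hilbert space `L²(𝕋)`. -/
abbrev L2Circle : Type := Lp ℂ 2 circleHaar

lemma circle_pow_surjective (N : ℕ) [NeZero N] :
    Function.Surjective (fun z : Circle => z ^ N) := by
  intro z
  refine ⟨Circle.exp (Complex.arg z / N), ?_⟩
  have hN : (N : ℝ) ≠ 0 := Nat.cast_ne_zero.mpr (NeZero.ne N)
  have h : (N : ℕ) • (Complex.arg z / N) = Complex.arg z := by
    rw [nsmul_eq_mul]
    field_simp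
  calc Circle.exp (Complex.arg z / N) ^ N
      = Circle.exp ((N : ℕ) • (Complex.arg z / N)) := by
        ext
        simp [Circle.coe_exp, ← Complex.exp_nat_mul]
    _ = z := by rw [h, Circle.exp_arg]

/-- The map `z ↦ z ^ N` preserves normalized Haar measure. -/
lemma circle_pow_measurePreserving (N : ℕ) [NeZero N] :
    MeasurePreserving (fun z : Circle => z ^ N) circleHaar circleHaar :=
  MonoidHom.measurePreserving (μ := circleHaar) (ν := circleHaar) (f := powMonoidHom N)
    (continuous_pow N) (circle_pow_surjective N) rfl

lemma memLp_filter (N : ℕ) [NeZero N] (m : C(Circle, ℂ)) (f : L2Circle) :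
    MemLp (fun z : Circle => m z * f (z ^ N)) 2 circleHaar :=
  MemLp.mul (p := ⊤) (q := 2)
    ((Lp.memLp f).comp_measurePreserving (circle_pow_measurePreserving N))
    (memLp_top_of_bound m.continuous.aestronglyMeasurable ‖m‖
      (Filter.Eventually.of_forall m.norm_coe_le_norm))

/-- The bounded operator `(S f)(z) = m(z) f(z ^ N)` on `L²(𝕋)` defined by a filter `m`. -/
def filterOperator (N : ℕ) [NeZero N] (m : C(Circle, ℂ)) : L2Circle →L[ℂ] L2Circle :=
  LinearMap.mkContinuous
    { toFun := fun f => (memLp_filter N m f).toLp _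
      map_add' := by
        intro f g
        rw [← MemLp.toLp_add]
        refine MemLp.toLp_congr _ _ ?_
        filter_upwards [(circle_pow_measurePreserving N).quasiMeasurePreserving.ae
          (Lp.coeFn_add f g)] with z hz
        exact (congrArg (m z * ·) hz).trans (mul_add _ _ _)
      map_smul' := by
        intro c f
        rw [RingHom.id_apply, ← MemLp.toLp_const_smul]
        refine MemLp.toLp_congr _ _ ?_
        filter_upwards [(circle_pow_measurePreserving N).quasiMeasurePreserving.ae
          (Lp.coeFn_smul c f)] with z hz
        exact (congrArg (m z * ·) hz).trans (mul_left_comm _ _ _) }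
    ‖m‖
    (by
      intro f
      have h1 : ‖(memLp_filter N m f).toLp _‖ ≤
          ‖m‖ * ‖Lp.compMeasurePreserving _ (circle_pow_measurePreserving N) f‖ := by
        refine Lp.norm_le_mul_norm_of_ae_le_mul ?_
        filter_upwards [(memLp_filter N m f).coeFn_toLp,
          Lp.coeFn_compMeasurePreserving f (circle_pow_measurePreserving N)] with z h1 h2
        rw [h1, h2, norm_mul]
        exact mul_le_mul_of_nonneg_right (m.norm_coe_le_norm z) (norm_nonneg _)
      rwa [Lp.norm_compMeasurePreserving] at h1)

/-- The defining formula `(S f)(z) = m(z) f(z ^ N)` holds almost everywhere. -/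
lemma filterOperator_coeFn (N : ℕ) [NeZero N] (m : C(Circle, ℂ)) (f : L2Circle) :
    filterOperator N m f =ᵐ[circleHaar] fun z => m z * f (z ^ N) :=
  (memLp_filter N m f).coeFn_toLp

/-- The basis vector `e_n(z) = z ^ n` of `L²(𝕋)`, `n ∈ ℤ`. -/
def circleMode (n : ℤ) : L2Circle :=
  ContinuousMap.toLp 2 circleHaar ℂ
    ⟨fun z : Circle => ((z ^ n : Circle) : ℂ), continuous_induced_dom.comp (continuous_zpow n)⟩

/-- The `N × N` matrix function `M_N(z) = N^{-1/2} (m_j(z e^{2π i k / N}))_{j,k}`. -/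
def filterMatrix (N : ℕ) (m : Fin N → C(Circle, ℂ)) (z : Circle) :
    Matrix (Fin N) (Fin N) ℂ :=
  Matrix.of fun j k =>
    ((1 / Real.sqrt N : ℝ) : ℂ) * m j (z * Circle.exp (2 * Real.pi * (k : ℕ) / N))

/-- The Cuntz relations `S_i^* S_j = δ_{ij} I` and `∑ S_i S_i^* = I`: the operators `S_i` define a
representation of the Cuntz algebra `O_N` on the Hilbert space `H`. -/
structure IsCuntzRepresentation {H : Type*} [NormedAddCommGroup H] [InnerProductSpace ℂ H]
    [CompleteSpace H] {N : ℕ} (S : Fin N → H →L[ℂ] H) : Prop where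
  orthogonality : ∀ i j : Fin N,
    (ContinuousLinearMap.adjoint (S i)).comp (S j) = if i = j then ContinuousLinearMap.id ℂ H else 0
  completeness : ∑ i : Fin N, (S i).comp (ContinuousLinearMap.adjoint (S i)) =
    ContinuousLinearMap.id ℂ H

/-- `S_{i_k}^* ⋯ S_{i_2}^* S_{i_1}^* v` for the word `(i_1, …, i_k)`. -/
def adjointWord {H : Type*} [NormedAddCommGroup H] [InnerProductSpace ℂ H]
    [CompleteSpace H] {N : ℕ} (S : Fin N → H →L[ℂ] H) {k : ℕ} (i : Fin k → Fin N) (v : H) : H :=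
  (List.ofFn i).foldl (fun w a => ContinuousLinearMap.adjoint (S a) w) v

/-- The `N`-adic rational `i_1 / N + ⋯ + i_k / N ^ k` of the word `(i_1, …, i_k)`. -/
def adicPoint {N k : ℕ} (i : Fin k → Fin N) : ℝ :=
  ∑ j : Fin k, ((i j : ℕ) : ℝ) / (N : ℝ) ^ ((j : ℕ) + 1)

/-- `μ` is the measure on `[0, 1]` induced by the operators `S_i` and the vector `v`: a Borel measure
carried by `[0, 1]`, of total mass `‖v‖ ^ 2`, whose value on each `N`-adic interval
`[ξ, ξ + N ^ (-k))`, `ξ = i_1 / N + ⋯ + i_k / N ^ k`, is `‖S_{i_k}^* ⋯ S_{i_1}^* v‖ ^ 2`. -/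
structure IsAdicMeasure {H : Type*} [NormedAddCommGroup H] [InnerProductSpace ℂ H]
    [CompleteSpace H] {N : ℕ} (S : Fin N → H →L[ℂ] H) (v : H) (μ : Measure ℝ) : Prop where
  carrier : μ (Set.Icc (0 : ℝ) 1)ᶜ = 0
  mass : μ Set.univ = ENNReal.ofReal (‖v‖ ^ 2)
  interval : ∀ (k : ℕ) (i : Fin k → Fin N),
    μ (Set.Ico (adicPoint i) (adicPoint i + 1 / (N : ℝ) ^ k)) =
      ENNReal.ofReal (‖adjointWord S i v‖ ^ 2)

/-- The filters `m_0 = (1 + z²)/√2`, `m_1 = z`, `m_2 = (1 - z²)/√2`. -/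
def cantorFilter : Fin 3 → C(Circle, ℂ) :=
  ![⟨fun z => (1 + (z : ℂ) ^ 2) / (Real.sqrt 2 : ℝ), by fun_prop⟩,
    ⟨fun z => (z : ℂ), by fun_prop⟩,
    ⟨fun z => (1 - (z : ℂ) ^ 2) / (Real.sqrt 2 : ℝ), by fun_prop⟩]

end

/-- The dimension `log 2 / log 3` of the Cantor set. -/
noncomputable abbrev cantorDim : ℝ := Real.log 2 / Real.log 3

lemma cantorDim_pos : 0 < cantorDim :=
  div_pos (Real.log_pos (by norm_num)) (Real.log_pos (by norm_num))

lemma cantorDim_le_one : cantorDim ≤ 1 :=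
  (div_le_one (Real.log_pos (by norm_num))).2 (Real.log_le_log (by norm_num) (by norm_num))

lemma three_rpow_cantorDim : (3 : ℝ) ^ cantorDim = 2 := by
  rw [Real.rpow_def_of_pos (by norm_num), cantorDim,
    mul_div_cancel₀ _ (Real.log_pos (by norm_num)).ne', Real.exp_log (by norm_num)]

lemma div_three_rpow_cantorDim {x : ℝ} (hx : 0 ≤ x) :
    (x / 3) ^ cantorDim = x ^ cantorDim / 2 := by
  rw [Real.div_rpow hx (by norm_num), three_rpow_cantorDim]

/-- The geometric inequality behind the optimal Hölder constant of the Cantor function. -/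
lemma rpow_add_rpow_le_gap {u v : ℝ} (hu : 0 ≤ u) (hu1 : u ≤ 1) (hv : 0 ≤ v) (hv1 : v ≤ 1) :
    u ^ cantorDim + v ^ cantorDim ≤ (1 + u + v) ^ cantorDim := by
  have hc := (Real.concaveOn_rpow cantorDim_pos.le cantorDim_le_one).2 (Set.mem_Ici.2 hu)
    (Set.mem_Ici.2 hv) (by norm_num : (0 : ℝ) ≤ 1 / 2) (by norm_num : (0 : ℝ) ≤ 1 / 2)
    (by norm_num)
  simp only [smul_eq_mul] at hc
  calc u ^ cantorDim + v ^ cantorDim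
      ≤ 2 * (1 / 2 * u + 1 / 2 * v) ^ cantorDim := by linarith
    _ = (3 * (1 / 2 * u + 1 / 2 * v)) ^ cantorDim := by
      rw [Real.mul_rpow (by norm_num) (by positivity), three_rpow_cantorDim]
    _ ≤ _ := Real.rpow_le_rpow (by positivity) (by linarith) cantorDim_pos.le

/-- The point of the Cantor set with a given address. -/
noncomputable def cantorPoint (a : ℕ → Bool) : ℝ :=
  Real.ofDigits fun i => cond (a i) (2 : Fin 3) 0

/-- The value of the Cantor function at the point with a given address. -/
noncomputable def dyadicPoint (a : ℕ → Bool) : ℝ :=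
  Real.ofDigits fun i => cond (a i) (1 : Fin 2) 0

lemma cantorPoint_nonneg (a : ℕ → Bool) : 0 ≤ cantorPoint a := Real.ofDigits_nonneg _

lemma cantorPoint_le_one (a : ℕ → Bool) : cantorPoint a ≤ 1 := Real.ofDigits_le_one _

lemma dyadicPoint_nonneg (a : ℕ → Bool) : 0 ≤ dyadicPoint a := Real.ofDigits_nonneg _

lemma dyadicPoint_le_one (a : ℕ → Bool) : dyadicPoint a ≤ 1 := Real.ofDigits_le_one _

lemma cantorPoint_eq (a : ℕ → Bool) :
    cantorPoint a = (cond (a 0) 2 0 + cantorPoint fun i => a (i + 1)) / 3 := by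
  rw [cantorPoint, Real.ofDigits_eq_sum_add_ofDigits _ 1]
  cases h : a 0 <;> simp [Real.ofDigitsTerm, h, cantorPoint] <;> ring

lemma dyadicPoint_eq (a : ℕ → Bool) :
    dyadicPoint a = (cond (a 0) 1 0 + dyadicPoint fun i => a (i + 1)) / 2 := by
  rw [dyadicPoint, Real.ofDigits_eq_sum_add_ofDigits _ 1]
  cases h : a 0 <;> simp [Real.ofDigitsTerm, h, dyadicPoint] <;> ring

lemma le_of_forall_le_add_half_pow {x y : ℝ} (h : ∀ n : ℕ, x ≤ y + (1 / 2) ^ n) : x ≤ y := by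
  have ht : Filter.Tendsto (fun n : ℕ => y + (1 / 2 : ℝ) ^ n) Filter.atTop (nhds (y + 0)) :=
    tendsto_const_nhds.add (tendsto_pow_atTop_nhds_zero_of_lt_one (by norm_num) (by norm_num))
  simpa using ge_of_tendsto' ht h

lemma dyadicPoint_le_rpow (a : ℕ → Bool) : dyadicPoint a ≤ cantorPoint a ^ cantorDim := by
  refine le_of_forall_le_add_half_pow fun n => ?_
  induction n generalizing a with
  | zero =>
    have := Real.rpow_nonneg (cantorPoint_nonneg a) cantorDim
    have := dyadicPoint_le_one a
    simp only [pow_zero]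
    linarith
  | succ n ih =>
    have h := ih fun i => a (i + 1)
    have h0 := cantorPoint_nonneg fun i => a (i + 1)
    have h1 := cantorPoint_le_one fun i => a (i + 1)
    rw [cantorPoint_eq, dyadicPoint_eq, pow_succ]
    cases a 0
    · rw [div_three_rpow_cantorDim (by simpa using h0)]
      simp only [cond_false, zero_add]
      linarith
    · rw [div_three_rpow_cantorDim (by simp only [cond_true]; linarith)]
      have := rpow_add_rpow_le_gap zero_le_one le_rfl h0 h1
      norm_num at this
      simp only [cond_true]
      linarith

lemma one_sub_dyadicPoint_le_rpow (a : ℕ → Bool) :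
    1 - dyadicPoint a ≤ (1 - cantorPoint a) ^ cantorDim := by
  refine le_of_forall_le_add_half_pow fun n => ?_
  induction n generalizing a with
  | zero =>
    have := Real.rpow_nonneg (sub_nonneg.2 (cantorPoint_le_one a)) cantorDim
    have := dyadicPoint_nonneg a
    simp only [pow_zero]
    linarith
  | succ n ih =>
    have h := ih fun i => a (i + 1)
    have h0 := cantorPoint_nonneg fun i => a (i + 1)
    have h1 := cantorPoint_le_one fun i => a (i + 1)
    rw [cantorPoint_eq, dyadicPoint_eq, pow_succ]
    generalize (cantorPoint fun i => a (i + 1)) = u at *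
    generalize (dyadicPoint fun i => a (i + 1)) = v at *
    cases a 0
    · rw [show 1 - (cond false 2 0 + u) / 3 = (1 + 1 + (1 - u)) / 3 by simp only [cond_false]; ring,
        div_three_rpow_cantorDim (by linarith)]
      have := rpow_add_rpow_le_gap zero_le_one le_rfl (sub_nonneg.2 h1) (by linarith)
      rw [Real.one_rpow] at this
      simp only [cond_false]
      generalize (1 - u) ^ cantorDim = A at *
      generalize (1 + 1 + (1 - u)) ^ cantorDim = B at *
      linarith
    · rw [show 1 - (cond true 2 0 + u) / 3 = (1 - u) / 3 by simp only [cond_true]; ring,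
        div_three_rpow_cantorDim (by linarith)]
      simp only [cond_true]
      linarith

/-- The Cantor function is Hölder of exponent `log 2 / log 3` with constant one. -/
lemma dyadicPoint_sub_le_rpow (a b : ℕ → Bool) :
    dyadicPoint b - dyadicPoint a ≤ |cantorPoint b - cantorPoint a| ^ cantorDim := by
  refine le_of_forall_le_add_half_pow fun n => ?_
  induction n generalizing a b with
  | zero =>
    have := Real.rpow_nonneg (abs_nonneg (cantorPoint b - cantorPoint a)) cantorDim
    have := dyadicPoint_le_one b
    have := dyadicPoint_nonneg a
    simp only [pow_zero]
    linarith
  | succ n ih =>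
    have h := ih (fun i => a (i + 1)) fun i => b (i + 1)
    have ha := one_sub_dyadicPoint_le_rpow fun i => a (i + 1)
    have hb := dyadicPoint_le_rpow fun i => b (i + 1)
    have ha0 := cantorPoint_nonneg fun i => a (i + 1)
    have ha1 := cantorPoint_le_one fun i => a (i + 1)
    have hb0 := cantorPoint_nonneg fun i => b (i + 1)
    have hb1 := cantorPoint_le_one fun i => b (i + 1)
    have hda := dyadicPoint_nonneg fun i => a (i + 1)
    have hdb := dyadicPoint_le_one fun i => b (i + 1)
    have hp : (0 : ℝ) ≤ (1 / 2) ^ n := by positivity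
    rw [cantorPoint_eq a, cantorPoint_eq b, dyadicPoint_eq a, dyadicPoint_eq b, pow_succ]
    generalize (cantorPoint fun i => a (i + 1)) = u at *
    generalize (dyadicPoint fun i => a (i + 1)) = v at *
    generalize (cantorPoint fun i => b (i + 1)) = u' at *
    generalize (dyadicPoint fun i => b (i + 1)) = v' at *
    have key (c : ℝ) : |(c + u') / 3 - (c + u) / 3| ^ cantorDim = |u' - u| ^ cantorDim / 2 := by
      rw [← div_three_rpow_cantorDim (abs_nonneg _), show (c + u') / 3 - (c + u) / 3 = (u' - u) / 3
        by ring, abs_div, abs_of_pos (by norm_num : (0 : ℝ) < 3)]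
    cases a 0 <;> cases b 0
    · rw [key]
      linarith
    · simp only [cond_false, cond_true]
      rw [show (2 + u') / 3 - (0 + u) / 3 = (1 + u' + (1 - u)) / 3 by ring,
        abs_of_nonneg (by linarith), div_three_rpow_cantorDim (by linarith)]
      have := rpow_add_rpow_le_gap hb0 hb1 (sub_nonneg.2 ha1) (by linarith)
      linarith
    · have := Real.rpow_nonneg (abs_nonneg ((cond false 2 0 + u') / 3 - (cond true 2 0 + u) / 3))
        cantorDim
      simp only [cond_false, cond_true] at this ⊢
      linarith
    · rw [key]
      linarith

/-- The Cantor function on the Cantor set, through ternary addresses. -/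
noncomputable def cantorStaircase (x : ℝ) : ℝ := dyadicPoint (cantorToBinary x).get

lemma cantorPoint_cantorToBinary {x : ℝ} (hx : x ∈ cantorSet) :
    cantorPoint (cantorToBinary x).get = x :=
  ofDigits_cantorToTernary hx

lemma holderOnWith_cantorStaircase :
    HolderOnWith 1 cantorDim.toNNReal cantorStaircase cantorSet := by
  intro x hx y hy
  have h : |cantorStaircase x - cantorStaircase y| ≤ |x - y| ^ cantorDim := by
    have h1 := dyadicPoint_sub_le_rpow (cantorToBinary x).get (cantorToBinary y).get
    have h2 := dyadicPoint_sub_le_rpow (cantorToBinary y).get (cantorToBinary x).get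
    rw [cantorPoint_cantorToBinary hx, cantorPoint_cantorToBinary hy] at h1 h2
    rw [abs_sub_comm] at h1
    exact abs_sub_le_iff.2 ⟨h2, h1⟩
  rw [edist_dist, edist_dist, Real.dist_eq, Real.dist_eq, ENNReal.coe_one, one_mul,
    Real.coe_toNNReal _ cantorDim_pos.le, ENNReal.ofReal_rpow_of_nonneg (abs_nonneg _) cantorDim_pos.le]
  exact ENNReal.ofReal_le_ofReal h

lemma Icc_subset_image_cantorStaircase :
    Set.Icc (0 : ℝ) 1 ⊆ cantorStaircase '' cantorSet := by
  intro y hy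
  obtain ⟨d, -, rfl⟩ := Real.ofDigits_SurjOn (b := 2) (by norm_num) hy
  let a : ℕ → Bool := fun i => decide (d i = 1)
  refine ⟨cantorSetEquivNatToBool.symm a, Subtype.coe_prop _, ?_⟩
  have h : (cantorToBinary (cantorSetEquivNatToBool.symm a)).get = a :=
    cantorSetEquivNatToBool.apply_symm_apply a
  rw [cantorStaircase, h, dyadicPoint]
  congr 1
  funext i
  simp only [a]
  generalize d i = e
  fin_cases e <;> rfl

lemma one_le_hausdorffMeasure_cantorSet : 1 ≤ Measure.hausdorffMeasure cantorDim cantorSet := by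
  have h := holderOnWith_cantorStaircase.hausdorffMeasure_image_le
    (Real.toNNReal_pos.2 cantorDim_pos) zero_le_one
  have h1 := measure_mono (μ := (Measure.hausdorffMeasure 1 : Measure ℝ))
    Icc_subset_image_cantorStaircase
  rw [hausdorffMeasure_real, Real.volume_Icc] at h1
  rw [hausdorffMeasure_real, Real.coe_toNNReal _ cantorDim_pos.le] at h
  simpa using h1.trans h

lemma cantorSet_subset_iUnion_cylinder (n : ℕ) :
    cantorSet ⊆ ⋃ w : Fin n → Bool, cantorPoint '' {a | ∀ j : Fin n, a j = w j} := by
  intro x hx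
  exact Set.mem_iUnion.2 ⟨fun j => (cantorToBinary x).get j, _, fun _ => rfl,
    cantorPoint_cantorToBinary hx⟩

lemma ediam_cylinder_le {n : ℕ} (w : Fin n → Bool) :
    Metric.ediam (cantorPoint '' {a | ∀ j : Fin n, a j = w j}) ≤
      ENNReal.ofReal ((3 ^ n : ℝ)⁻¹) := by
  refine Metric.ediam_le ?_
  rintro _ ⟨a, ha, rfl⟩ _ ⟨b, hb, rfl⟩
  rw [edist_dist, Real.dist_eq]
  refine ENNReal.ofReal_le_ofReal ?_
  have := Real.abs_ofDigits_sub_ofDigits_le (b := 3) (n := n)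
    (x := fun i => cond (a i) (2 : Fin 3) 0) (y := fun i => cond (b i) (2 : Fin 3) 0)
    (fun i hi => by simp only [(ha ⟨i, hi⟩).trans (hb ⟨i, hi⟩).symm])
  exact_mod_cast this

lemma hausdorffMeasure_cantorSet_le_one : Measure.hausdorffMeasure cantorDim cantorSet ≤ 1 := by
  have hr : Filter.Tendsto (fun n : ℕ => ENNReal.ofReal ((3 ^ n : ℝ)⁻¹)) Filter.atTop (nhds 0) := by
    rw [← ENNReal.ofReal_zero]
    refine ENNReal.tendsto_ofReal ?_
    simp_rw [← inv_pow]
    exact tendsto_pow_atTop_nhds_zero_of_lt_one (by norm_num) (by norm_num)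
  refine (Measure.hausdorffMeasure_le_liminf_sum cantorDim cantorSet _ hr
    (fun n (w : Fin n → Bool) => cantorPoint '' {a | ∀ j : Fin n, a j = w j})
    (Filter.Eventually.of_forall fun n w => ediam_cylinder_le w)
    (Filter.Eventually.of_forall cantorSet_subset_iUnion_cylinder)).trans ?_
  refine Filter.liminf_le_of_le (by isBoundedDefault) fun b hb => ?_
  obtain ⟨n, hn⟩ := hb.exists
  refine hn.trans ?_
  calc _ ≤ ∑ _w : Fin n → Bool, ENNReal.ofReal ((3 ^ n : ℝ)⁻¹) ^ cantorDim :=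
        Finset.sum_le_sum fun w _ =>
          ENNReal.rpow_le_rpow (ediam_cylinder_le w) cantorDim_pos.le
    _ = 1 := by
      have h : ((3 ^ n : ℝ)⁻¹) ^ cantorDim = (2 ^ n)⁻¹ := by
        rw [Real.inv_rpow (by positivity), ← Real.rpow_natCast, ← Real.rpow_mul (by norm_num),
          mul_comm, Real.rpow_mul (by norm_num), three_rpow_cantorDim, Real.rpow_natCast]
      rw [ENNReal.ofReal_rpow_of_nonneg (by positivity) cantorDim_pos.le, h]
      simp only [Finset.sum_const, Finset.card_univ, Fintype.card_fun, Fintype.card_bool,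
        Fintype.card_fin, nsmul_eq_mul]
      rw [ENNReal.ofReal_inv_of_pos (by positivity), ENNReal.ofReal_pow (by norm_num)]
      push_cast
      rw [ENNReal.ofReal_ofNat]
      exact ENNReal.mul_inv_cancel (by simp) (by simp)

/-- The middle-third Cantor set has Hausdorff measure one in its dimension. -/
lemma hausdorffMeasure_cantorSet : Measure.hausdorffMeasure cantorDim cantorSet = 1 :=
  hausdorffMeasure_cantorSet_le_one.antisymm one_le_hausdorffMeasure_cantorSet

open scoped Pointwise in
lemma hausdorffMeasure_image_add_div_three (c : ℝ) (A : Set ℝ) :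
    Measure.hausdorffMeasure cantorDim ((fun x => (c + x) / 3) '' A) =
      ENNReal.ofReal (1 / 2) * Measure.hausdorffMeasure cantorDim A := by
  have h : (fun x => (c + x) / 3) '' A = IsometryEquiv.addLeft (c / 3) '' ((3⁻¹ : ℝ) • A) := by
    rw [← Set.image_smul, Set.image_image]
    refine Set.image_congr fun x _ => ?_
    simp only [IsometryEquiv.addLeft_apply, smul_eq_mul]
    ring
  rw [h, IsometryEquiv.hausdorffMeasure_image,
    Measure.hausdorffMeasure_smul₀ cantorDim_pos.le (by norm_num), ENNReal.smul_def, smul_eq_mul]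
  congr 1
  rw [← ENNReal.ofReal_coe_nnreal, NNReal.coe_rpow, coe_nnnorm, Real.norm_of_nonneg (by norm_num),
    Real.inv_rpow (by norm_num), three_rpow_cantorDim, one_div]

lemma mem_cantorSet_iff {x : ℝ} :
    x ∈ cantorSet ↔ (∃ y ∈ cantorSet, y / 3 = x) ∨ ∃ y ∈ cantorSet, (2 + y) / 3 = x := by
  conv_lhs => rw [cantorSet_eq_union_halves]
  rfl

lemma adicPoint_succ {N k : ℕ} (i : Fin (k + 1) → Fin N) :
    adicPoint i = ((i 0 : ℕ) + adicPoint fun j => i j.succ) / N := by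
  rw [adicPoint, Fin.sum_univ_succ, add_div, adicPoint, Finset.sum_div]
  congr 1
  · simp
  · exact Finset.sum_congr rfl fun j _ => by rw [Fin.val_succ, pow_succ _ (_ + 1), div_div]

lemma adicPoint_nonneg {N k : ℕ} (i : Fin k → Fin N) : 0 ≤ adicPoint i :=
  Finset.sum_nonneg fun _ _ => by positivity

lemma adicPoint_add_le_one {N k : ℕ} (i : Fin k → Fin N) :
    adicPoint i + 1 / (N : ℝ) ^ k ≤ 1 := by
  induction k with
  | zero => simp [adicPoint]
  | succ k ih =>
    have hN : 0 < (N : ℝ) := Nat.cast_pos.2 (i 0).pos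
    have hi : ((i 0 : ℕ) : ℝ) + 1 ≤ N := by exact_mod_cast (i 0).isLt
    rw [adicPoint_succ, pow_succ, ← div_div, ← add_div, div_le_one hN]
    linarith [ih fun j => i j.succ]

/-- The mass that the Cantor measure gives to the triadic interval of a word. -/
noncomputable def cantorWeight {k : ℕ} (i : Fin k → Fin 3) : ℝ :=
  ∏ j, if i j = 1 then 0 else 1 / 2

lemma cantorWeight_succ {k : ℕ} (i : Fin (k + 1) → Fin 3) :
    cantorWeight i = (if i 0 = 1 then 0 else 1 / 2) * cantorWeight fun j => i j.succ :=
  Fin.prod_univ_succ _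

lemma cantorSet_inter_Ico_zero {a b : ℝ} (hb1 : b ≤ 1) :
    cantorSet ∩ Set.Ico (a / 3) (b / 3) =
      (fun x => (0 + x) / 3) '' (cantorSet ∩ Set.Ico a b) := by
  ext x
  constructor
  · rintro ⟨hx, h1, h2⟩
    obtain ⟨y, hy, rfl⟩ | ⟨y, hy, rfl⟩ := mem_cantorSet_iff.1 hx
    · exact ⟨y, ⟨hy, by linarith, by linarith⟩, by simp⟩
    · linarith [(cantorSet_subset_unitInterval hy).1]
  · rintro ⟨y, ⟨hy, h1, h2⟩, rfl⟩
    exact ⟨mem_cantorSet_iff.2 (Or.inl ⟨y, hy, by simp⟩), by simp only; linarith,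
      by simp only; linarith⟩

lemma cantorSet_inter_Ico_two {a b : ℝ} (ha : 0 ≤ a) :
    cantorSet ∩ Set.Ico ((2 + a) / 3) ((2 + b) / 3) =
      (fun x => (2 + x) / 3) '' (cantorSet ∩ Set.Ico a b) := by
  ext x
  constructor
  · rintro ⟨hx, h1, h2⟩
    obtain ⟨y, hy, rfl⟩ | ⟨y, hy, rfl⟩ := mem_cantorSet_iff.1 hx
    · linarith [(cantorSet_subset_unitInterval hy).2]
    · exact ⟨y, ⟨hy, by linarith, by linarith⟩, rfl⟩
  · rintro ⟨y, ⟨hy, h1, h2⟩, rfl⟩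
    exact ⟨mem_cantorSet_iff.2 (Or.inr ⟨y, hy, rfl⟩), by simp only; linarith,
      by simp only; linarith⟩

lemma cantorSet_inter_Ico_one_subset {a b : ℝ} (ha : 0 ≤ a) (hb1 : b ≤ 1) :
    cantorSet ∩ Set.Ico ((1 + a) / 3) ((1 + b) / 3) ⊆ {1 / 3} := by
  rintro x ⟨hx, h1, h2⟩
  obtain ⟨y, hy, rfl⟩ | ⟨y, hy, rfl⟩ := mem_cantorSet_iff.1 hx
  · have := (cantorSet_subset_unitInterval hy).2
    exact Set.mem_singleton_iff.2 (by linarith)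
  · linarith [(cantorSet_subset_unitInterval hy).1]

/-- The Cantor measure of a triadic interval. -/
lemma hausdorffMeasure_cantorSet_inter_Ico {k : ℕ} (i : Fin k → Fin 3) :
    Measure.hausdorffMeasure cantorDim
      (cantorSet ∩ Set.Ico (adicPoint i) (adicPoint i + 1 / 3 ^ k)) =
      ENNReal.ofReal (cantorWeight i) := by
  have := Measure.nullSingletonClass_hausdorff ℝ cantorDim_pos
  induction k with
  | zero =>
    have h : cantorSet ∩ Set.Ico (0 : ℝ) 1 = cantorSet \ {1} := by
      ext x
      constructor
      · rintro ⟨hx, -, h⟩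
        exact ⟨hx, h.ne⟩
      · rintro ⟨hx, h⟩
        have := cantorSet_subset_unitInterval hx
        exact ⟨hx, this.1, lt_of_le_of_ne this.2 h⟩
    simp [adicPoint, cantorWeight, h, measure_sdiff_null, hausdorffMeasure_cantorSet]
  | succ k ih =>
    have h0 := adicPoint_nonneg fun j => i j.succ
    have h1 := adicPoint_add_le_one fun j => i j.succ
    have ih' := ih fun j => i j.succ
    have hs : adicPoint i + 1 / 3 ^ (k + 1) =
        ((i 0 : ℕ) + (adicPoint (fun j => i j.succ) + 1 / 3 ^ k)) / 3 := by
      rw [adicPoint_succ, pow_succ]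
      push_cast
      ring
    rw [hs, adicPoint_succ, cantorWeight_succ]
    push_cast at h1 ⊢
    generalize adicPoint (fun j => i j.succ) = a at *
    generalize i 0 = d
    rcases (by fin_cases d <;> simp : d = 0 ∨ d = 1 ∨ d = 2) with rfl | rfl | rfl
    · simp only [Fin.val_zero, Nat.cast_zero, zero_add]
      rw [cantorSet_inter_Ico_zero h1, hausdorffMeasure_image_add_div_three, ih',
        if_neg (by decide), ENNReal.ofReal_mul (by norm_num)]
    · rw [if_pos rfl, zero_mul, ENNReal.ofReal_zero]
      simp only [Fin.val_one, Nat.cast_one]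
      exact measure_mono_null (cantorSet_inter_Ico_one_subset h0 h1) (measure_singleton _)
    · simp only [Fin.val_two, Nat.cast_ofNat]
      rw [cantorSet_inter_Ico_two h0, hausdorffMeasure_image_add_div_three, ih',
        if_neg (by decide), ENNReal.ofReal_mul (by norm_num)]

lemma exists_adicPoint_eq {N : ℕ} (k m : ℕ) (hm : m < N ^ k) :
    ∃ i : Fin k → Fin N, adicPoint i = m / (N : ℝ) ^ k := by
  induction k generalizing m with
  | zero => exact ⟨Fin.elim0, by simp_all [adicPoint]⟩
  | succ k ih =>
    have hN : 0 < N := Nat.pos_of_ne_zero fun h => by simp [h] at hm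
    obtain ⟨i, hi⟩ := ih (m % N ^ k) (Nat.mod_lt _ (by positivity))
    refine ⟨Fin.cons ⟨m / N ^ k, Nat.div_lt_of_lt_mul (by rwa [← pow_succ])⟩ i, ?_⟩
    rw [adicPoint_succ]
    simp only [Fin.cons_zero, Fin.cons_succ, hi]
    have h : ((m / N ^ k : ℕ) : ℝ) * N ^ k + (m % N ^ k : ℕ) = m := by
      exact_mod_cast Nat.div_add_mod' m (N ^ k)
    have hN' : (N : ℝ) ≠ 0 := by positivity
    rw [← h]
    field_simp
    ring

section uniqueness

variable {H : Type*} [NormedAddCommGroup H] [InnerProductSpace ℂ H] [CompleteSpace H] {N : ℕ}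
  {S : Fin N → H →L[ℂ] H} {v : H} {μ ν : Measure ℝ}

lemma IsAdicMeasure.measure_Iio_adic_eq (hμ : IsAdicMeasure S v μ) (hν : IsAdicMeasure S v ν)
    (k m : ℕ) (hm : m ≤ N ^ k) :
    μ (Set.Iio (m / (N : ℝ) ^ k)) = ν (Set.Iio (m / (N : ℝ) ^ k)) := by
  induction m with
  | zero =>
    have h : Set.Iio (((0 : ℕ) : ℝ) / (N : ℝ) ^ k) ⊆ (Set.Icc (0 : ℝ) 1)ᶜ := by
      intro x hx hx'
      simp only [Nat.cast_zero, zero_div, Set.mem_Iio] at hx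
      exact hx.not_ge hx'.1
    rw [measure_mono_null h hμ.carrier, measure_mono_null h hν.carrier]
  | succ m ih =>
    obtain ⟨i, hi⟩ := exists_adicPoint_eq k m hm
    have hle : (m : ℝ) / (N : ℝ) ^ k ≤ m / (N : ℝ) ^ k + 1 / (N : ℝ) ^ k :=
      le_add_of_nonneg_right (by positivity)
    have hd : Disjoint (Set.Iio (m / (N : ℝ) ^ k))
        (Set.Ico (m / (N : ℝ) ^ k) (m / (N : ℝ) ^ k + 1 / (N : ℝ) ^ k)) :=
      Set.disjoint_left.2 fun x hx hx' => (Set.mem_Iio.1 hx).not_ge hx'.1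
    rw [Nat.cast_succ, add_div, ← Set.Iio_union_Ico_eq_Iio hle,
      measure_union hd measurableSet_Ico, measure_union hd measurableSet_Ico,
      ih (Nat.le_of_succ_le hm), ← hi, hμ.interval, hν.interval]

lemma IsAdicMeasure.measure_Iio_of_one_le (hμ : IsAdicMeasure S v μ) {a : ℝ} (ha : 1 ≤ a) :
    μ (Set.Iio a) = ENNReal.ofReal (‖v‖ ^ 2) := by
  refine le_antisymm (hμ.mass ▸ measure_mono (Set.subset_univ _)) ?_
  have h := hμ.interval 0 Fin.elim0
  simp only [adicPoint, adjointWord, Finset.univ_eq_empty, Finset.sum_empty, pow_zero, div_one,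
    zero_add, List.ofFn_zero, List.foldl_nil] at h
  rw [← h]
  exact measure_mono fun x hx => hx.2.trans_le ha

lemma exists_adic_between (hN : 1 < N) {x a : ℝ} (hxa : x < a) (ha0 : 0 ≤ a) (ha1 : a ≤ 1) :
    ∃ k m : ℕ, m ≤ N ^ k ∧ x < m / (N : ℝ) ^ k ∧ m / (N : ℝ) ^ k ≤ a := by
  have hN' : (1 : ℝ) < N := by exact_mod_cast hN
  obtain ⟨k, hk⟩ := pow_unbounded_of_one_lt (1 / (a - x)) hN'
  have hp : (0 : ℝ) < (N : ℝ) ^ k := by positivity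
  have hfl := Nat.floor_le (mul_nonneg ha0 hp.le)
  refine ⟨k, ⌊a * (N : ℝ) ^ k⌋₊, ?_, ?_, (div_le_iff₀ hp).2 hfl⟩
  · have : ((⌊a * (N : ℝ) ^ k⌋₊ : ℕ) : ℝ) ≤ (N : ℝ) ^ k := hfl.trans (mul_le_of_le_one_left hp.le ha1)
    exact_mod_cast this
  · rw [lt_div_iff₀ hp]
    have h1 := Nat.lt_floor_add_one (a * (N : ℝ) ^ k)
    rw [div_lt_iff₀ (sub_pos.2 hxa)] at hk
    linarith

/-- An adic measure is determined by the operators and the vector. -/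
lemma IsAdicMeasure.unique (hN : 1 < N) (hμ : IsAdicMeasure S v μ) (hν : IsAdicMeasure S v ν) :
    μ = ν := by
  have : IsFiniteMeasure μ := ⟨by rw [hμ.mass]; exact ENNReal.ofReal_lt_top⟩
  have : IsFiniteMeasure ν := ⟨by rw [hν.mass]; exact ENNReal.ofReal_lt_top⟩
  have hIio (a : ℝ) : μ (Set.Iio a) = ν (Set.Iio a) := by
    rcases le_total 1 a with ha1 | ha1
    · rw [hμ.measure_Iio_of_one_le ha1, hν.measure_Iio_of_one_le ha1]
    rcases lt_or_ge a 0 with ha0 | ha0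
    · have h : Set.Iio a ⊆ (Set.Icc (0 : ℝ) 1)ᶜ :=
        fun x hx hx' => (hx'.1.trans_lt hx).not_gt ha0
      rw [measure_mono_null h hμ.carrier, measure_mono_null h hν.carrier]
    let Q : Set (ℕ × ℕ) := {p | p.2 ≤ N ^ p.1 ∧ (p.2 : ℝ) / (N : ℝ) ^ p.1 ≤ a}
    have hU : Set.Iio a = ⋃ p : Q, Set.Iio ((p.1.2 : ℝ) / (N : ℝ) ^ p.1.1) := by
      ext x
      simp only [Set.mem_iUnion, Set.mem_Iio]
      constructor
      · intro hx
        obtain ⟨k, m, h1, h2, h3⟩ := exists_adic_between hN hx ha0 ha1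
        exact ⟨⟨(k, m), h1, h3⟩, h2⟩
      · rintro ⟨p, hp⟩
        exact hp.trans_le p.2.2
    have hdir : Directed (· ⊆ ·) fun p : Q => Set.Iio ((p.1.2 : ℝ) / (N : ℝ) ^ p.1.1) := by
      intro p q
      rcases le_total ((p.1.2 : ℝ) / (N : ℝ) ^ p.1.1) ((q.1.2 : ℝ) / (N : ℝ) ^ q.1.1) with h | h
      · exact ⟨q, Set.Iio_subset_Iio h, subset_rfl⟩
      · exact ⟨p, subset_rfl, Set.Iio_subset_Iio h⟩
    rw [hU, hdir.measure_iUnion, hdir.measure_iUnion]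
    exact iSup_congr fun p => hμ.measure_Iio_adic_eq hν _ _ p.2.1
  refine Measure.ext_of_Ici μ ν fun a => ?_
  rw [← Set.compl_Iio, measure_compl measurableSet_Iio (measure_ne_top _ _),
    measure_compl measurableSet_Iio (measure_ne_top _ _), hIio, hμ.mass, hν.mass]

end uniqueness

lemma cube_root_unity : ∃ w : Circle, (∀ k : Fin 3,
    Circle.exp (2 * Real.pi * (k : ℕ) / (3 : ℕ)) = w ^ (k : ℕ)) ∧ w ^ 3 = 1 ∧
    1 + (w : ℂ) + (w : ℂ) ^ 2 = 0 := by
  have hprim := Complex.isPrimitiveRoot_exp 3 (by norm_num)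
  have hw : ((Circle.exp (2 * Real.pi / 3) : Circle) : ℂ) =
      Complex.exp (2 * Real.pi * Complex.I / (3 : ℕ)) := by
    rw [Circle.coe_exp]
    congr 1
    push_cast
    ring
  refine ⟨Circle.exp (2 * Real.pi / 3), fun k => ?_, ?_, ?_⟩
  · ext
    rw [Circle.coe_pow, Circle.coe_exp, Circle.coe_exp, ← Complex.exp_nat_mul]
    congr 1
    push_cast
    ring
  · ext
    rw [Circle.coe_pow, hw, hprim.pow_eq_one, Circle.coe_one]
  · have h := hprim.geom_sum_eq_zero (by norm_num)
    rw [hw]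
    simpa [Finset.sum_range_succ] using h

lemma cantorFilter_zero_apply (z : Circle) :
    cantorFilter 0 z = (1 + (z : ℂ) ^ 2) / (Real.sqrt 2 : ℝ) := rfl

lemma cantorFilter_one_apply (z : Circle) : cantorFilter 1 z = z := rfl

lemma cantorFilter_two_apply (z : Circle) :
    cantorFilter 2 z = (1 - (z : ℂ) ^ 2) / (Real.sqrt 2 : ℝ) := rfl

lemma inv_sqrt_two_sq : ((Real.sqrt 2 : ℝ) : ℂ)⁻¹ ^ 2 = 1 / 2 := by
  rw [inv_pow, ← Complex.ofReal_pow, Real.sq_sqrt (by norm_num)]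
  norm_num

lemma sum_cantorFilter_mul_star (z : Circle) (i j : Fin 3) :
    ∑ k : Fin 3, cantorFilter i (z * Circle.exp (2 * Real.pi * (k : ℕ) / (3 : ℕ))) *
      star (cantorFilter j (z * Circle.exp (2 * Real.pi * (k : ℕ) / (3 : ℕ)))) =
      if i = j then 3 else 0 := by
  obtain ⟨w, hexp, hw3, hw⟩ := cube_root_unity
  simp_rw [hexp]
  have hz' : (z : ℂ) * star (z : ℂ) = 1 := by
    simpa [Complex.normSq_eq_conj_mul_self, mul_comm] using Complex.mul_conj (z : ℂ)
  have hw' : star (w : ℂ) = (w : ℂ) ^ 2 := by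
    rw [← Circle.coe_pow, eq_inv_of_mul_eq_one_left ((pow_succ w 2).symm.trans hw3),
      Circle.coe_inv_eq_conj]
    rfl
  have hc := inv_sqrt_two_sq
  have hcs : star ((Real.sqrt 2 : ℝ) : ℂ)⁻¹ = ((Real.sqrt 2 : ℝ) : ℂ)⁻¹ := by
    rw [star_inv₀]
    congr 1
    exact Complex.conj_ofReal _
  simp only [Fin.sum_univ_three, Fin.val_zero, Fin.val_one, Fin.val_two, pow_zero, pow_one, mul_one]
  rcases (by fin_cases i <;> simp : i = 0 ∨ i = 1 ∨ i = 2) with rfl | rfl | rfl <;>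
  rcases (by fin_cases j <;> simp : j = 0 ∨ j = 1 ∨ j = 2) with rfl | rfl | rfl <;>
  simp only [cantorFilter_zero_apply, cantorFilter_one_apply, cantorFilter_two_apply,
    Circle.coe_mul, Circle.coe_pow, div_eq_mul_inv, star_mul', star_add, star_sub, star_pow,
    star_one, hw', hcs, reduceIte, Fin.reduceEq] <;>
  generalize ((Real.sqrt 2 : ℝ) : ℂ)⁻¹ = c at * <;>
  generalize star (z : ℂ) = z' at * <;>
  generalize (z : ℂ) = x at * <;>
  generalize (w : ℂ) = y at * <;>
  clear hexp hw3 hcs hw' <;>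
  grind

lemma filterMatrix_cantorFilter_mem_unitaryGroup (z : Circle) :
    filterMatrix 3 cantorFilter z ∈ Matrix.unitaryGroup (Fin 3) ℂ := by
  rw [Matrix.mem_unitaryGroup_iff]
  ext i j
  have h := sum_cantorFilter_mul_star z i j
  have h3 : ((1 / Real.sqrt (3 : ℕ) : ℝ) : ℂ) * ((1 / Real.sqrt (3 : ℕ) : ℝ) : ℂ) = 1 / 3 := by
    rw [← Complex.ofReal_mul, div_mul_div_comm, Real.mul_self_sqrt (by positivity)]
    norm_num
  calc (filterMatrix 3 cantorFilter z * star (filterMatrix 3 cantorFilter z)) i j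
      = 1 / 3 * ∑ k : Fin 3,
          cantorFilter i (z * Circle.exp (2 * Real.pi * (k : ℕ) / (3 : ℕ))) *
          star (cantorFilter j (z * Circle.exp (2 * Real.pi * (k : ℕ) / (3 : ℕ)))) := by
        rw [Matrix.mul_apply, Finset.mul_sum]
        refine Finset.sum_congr rfl fun k _ => ?_
        rw [Matrix.star_apply, filterMatrix, Matrix.of_apply, Matrix.of_apply, star_mul',
          Complex.star_def, Complex.conj_ofReal, ← h3]
        ring
    _ = (1 : Matrix (Fin 3) (Fin 3) ℂ) i j := by
        rw [h, Matrix.one_apply]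
        split_ifs <;> norm_num

lemma integral_comp_pow {N : ℕ} [NeZero N] {φ : Circle → ℂ} (hφ : Integrable φ circleHaar) :
    ∫ z, φ (z ^ N) ∂circleHaar = ∫ z, φ z ∂circleHaar := by
  have hp := circle_pow_measurePreserving N
  conv_rhs => rw [← hp.map_eq]
  rw [integral_map hp.measurable.aemeasurable (hp.map_eq.symm ▸ hφ.aestronglyMeasurable)]

lemma integrable_mul_comp_pow {N : ℕ} [NeZero N] {φ : Circle → ℂ} (hφ : Integrable φ circleHaar)
    (m : C(Circle, ℂ)) : Integrable (fun z => m z * φ (z ^ N)) circleHaar :=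
  ((circle_pow_measurePreserving N).integrable_comp_of_integrable hφ).bdd_mul
    m.continuous.aestronglyMeasurable (Filter.Eventually.of_forall m.norm_coe_le_norm)

/-- Averaging over the fibres of `z ↦ z ^ N`. -/
lemma integral_mul_comp_pow_average {N : ℕ} [NeZero N] {φ : Circle → ℂ}
    (hφ : Integrable φ circleHaar) (m : C(Circle, ℂ)) {ι : Type*} [Fintype ι] (g : ι → Circle)
    (hg : ∀ k, g k ^ N = 1) :
    (Fintype.card ι : ℂ) * ∫ z, m z * φ (z ^ N) ∂circleHaar =
      ∫ z, (∑ k, m (z * g k)) * φ (z ^ N) ∂circleHaar := by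
  have hk (k : ι) : ∫ z, m (z * g k) * φ (z ^ N) ∂circleHaar =
      ∫ z, m z * φ (z ^ N) ∂circleHaar := by
    rw [← integral_mul_right_eq_self (fun z => m z * φ (z ^ N)) (g k)]
    simp only [mul_pow, hg, mul_one]
  simp_rw [Finset.sum_mul]
  rw [integral_finsetSum]
  · simp only [hk, Finset.sum_const, Finset.card_univ, nsmul_eq_mul]
  · intro k _
    exact integrable_mul_comp_pow hφ (m.comp ⟨fun z => z * g k, by fun_prop⟩)

lemma inner_filterOperator_cantorFilter (i j : Fin 3) (f g : L2Circle) :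
    inner ℂ (filterOperator 3 (cantorFilter i) f) (filterOperator 3 (cantorFilter j) g) =
      if i = j then inner ℂ f g else 0 := by
  have hφ : Integrable (fun z => inner ℂ (f z) (g z)) circleHaar := L2.integrable_inner f g
  have h1 : inner ℂ (filterOperator 3 (cantorFilter i) f) (filterOperator 3 (cantorFilter j) g) =
      ∫ z, (cantorFilter j * star (cantorFilter i)) z *
        (fun z => inner ℂ (f z) (g z)) (z ^ 3) ∂circleHaar := by
    rw [L2.inner_def]
    refine integral_congr_ae ?_
    filter_upwards [filterOperator_coeFn 3 (cantorFilter i) f,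
      filterOperator_coeFn 3 (cantorFilter j) g] with z hf hg
    rw [hf, hg]
    simp only [RCLike.inner_apply, map_mul, ContinuousMap.mul_apply, ContinuousMap.star_apply,
      RCLike.star_def]
    ring
  obtain ⟨w, hexp, hw3, -⟩ := cube_root_unity
  have h2 := integral_mul_comp_pow_average hφ (cantorFilter j * star (cantorFilter i))
    (fun k : Fin 3 => Circle.exp (2 * Real.pi * (k : ℕ) / (3 : ℕ)))
    (fun k => by rw [hexp, ← pow_mul, mul_comm, pow_mul, hw3, one_pow])
  simp only [ContinuousMap.mul_apply, ContinuousMap.star_apply, sum_cantorFilter_mul_star,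
    Fintype.card_fin] at h2
  rw [integral_const_mul, integral_comp_pow hφ] at h2
  simp only [ContinuousMap.mul_apply, ContinuousMap.star_apply] at h1
  rw [h1, L2.inner_def]
  refine mul_left_cancel₀ (by norm_num : ((3 : ℕ) : ℂ) ≠ 0) (h2.trans ?_)
  by_cases hij : i = j
  · simp [hij]
  · simp [hij, Ne.symm hij]

lemma adjoint_comp_filterOperator_cantorFilter (i j : Fin 3) :
    (ContinuousLinearMap.adjoint (filterOperator 3 (cantorFilter i))).comp
      (filterOperator 3 (cantorFilter j)) =
      if i = j then ContinuousLinearMap.id ℂ L2Circle else 0 := by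
  ext1 g
  refine ext_inner_left ℂ fun f => ?_
  rw [ContinuousLinearMap.comp_apply, ContinuousLinearMap.adjoint_inner_right,
    inner_filterOperator_cantorFilter]
  split_ifs <;> simp

lemma coeFn_circleMode (n : ℤ) :
    circleMode n =ᵐ[circleHaar] fun z => ((z ^ n : Circle) : ℂ) :=
  ContinuousMap.coeFn_toLp circleHaar _

/-- The action of a filter operator on modes, given a pointwise identity. -/
lemma filterOperator_circleMode (N : ℕ) [NeZero N] (m : C(Circle, ℂ)) (n : ℤ) :
    filterOperator N m (circleMode n) =ᵐ[circleHaar] fun z => m z * ((z ^ N) ^ n : Circle) := by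
  filter_upwards [filterOperator_coeFn N m (circleMode n),
    (circle_pow_measurePreserving N).quasiMeasurePreserving.ae (coeFn_circleMode n)] with z h1 h2
  rw [h1, h2]

lemma circleMode_three_mul (n : ℤ) :
    circleMode (3 * n) = ((Real.sqrt 2 : ℝ) : ℂ)⁻¹ •
      (filterOperator 3 (cantorFilter 0) (circleMode n) +
        filterOperator 3 (cantorFilter 2) (circleMode n)) := by
  refine Lp.ext ?_
  filter_upwards [coeFn_circleMode (3 * n), filterOperator_circleMode 3 (cantorFilter 0) n,
    filterOperator_circleMode 3 (cantorFilter 2) n, Lp.coeFn_smul ((Real.sqrt 2 : ℝ) : ℂ)⁻¹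
      (filterOperator 3 (cantorFilter 0) (circleMode n) +
        filterOperator 3 (cantorFilter 2) (circleMode n)),
    Lp.coeFn_add (filterOperator 3 (cantorFilter 0) (circleMode n))
      (filterOperator 3 (cantorFilter 2) (circleMode n))] with z h h0 h2 hs ha
  rw [h, hs, Pi.smul_apply, ha, Pi.add_apply, h0, h2, cantorFilter_zero_apply,
    cantorFilter_two_apply, zpow_mul, zpow_ofNat, smul_eq_mul, div_eq_mul_inv, div_eq_mul_inv]
  linear_combination (-2 * (((z ^ 3) ^ n : Circle) : ℂ)) * inv_sqrt_two_sq

lemma circleMode_three_mul_add_one (n : ℤ) :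
    circleMode (3 * n + 1) = filterOperator 3 (cantorFilter 1) (circleMode n) := by
  refine Lp.ext ?_
  filter_upwards [coeFn_circleMode (3 * n + 1),
    filterOperator_circleMode 3 (cantorFilter 1) n] with z h h1
  rw [h, h1, cantorFilter_one_apply, zpow_add, zpow_mul, zpow_ofNat, zpow_one, Circle.coe_mul,
    mul_comm]

lemma circleMode_three_mul_add_two (n : ℤ) :
    circleMode (3 * n + 2) = ((Real.sqrt 2 : ℝ) : ℂ)⁻¹ •
      (filterOperator 3 (cantorFilter 0) (circleMode n) -
        filterOperator 3 (cantorFilter 2) (circleMode n)) := by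
  refine Lp.ext ?_
  filter_upwards [coeFn_circleMode (3 * n + 2), filterOperator_circleMode 3 (cantorFilter 0) n,
    filterOperator_circleMode 3 (cantorFilter 2) n, Lp.coeFn_smul ((Real.sqrt 2 : ℝ) : ℂ)⁻¹
      (filterOperator 3 (cantorFilter 0) (circleMode n) -
        filterOperator 3 (cantorFilter 2) (circleMode n)),
    Lp.coeFn_sub (filterOperator 3 (cantorFilter 0) (circleMode n))
      (filterOperator 3 (cantorFilter 2) (circleMode n))] with z h h0 h2 hs ha
  rw [h, hs, Pi.smul_apply, ha, Pi.sub_apply, h0, h2, cantorFilter_zero_apply,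
    cantorFilter_two_apply, zpow_add, zpow_mul, zpow_ofNat, zpow_ofNat, Circle.coe_mul,
    Circle.coe_pow z 2, smul_eq_mul, div_eq_mul_inv, div_eq_mul_inv]
  linear_combination (-2 * (((z ^ 3) ^ n : Circle) : ℂ) * (z : ℂ) ^ 2) * inv_sqrt_two_sq

/-- Operators on `L²(𝕋)` are determined by their values on the modes. -/
lemma ext_circleMode {A B : L2Circle →L[ℂ] L2Circle} (h : ∀ n, A (circleMode n) = B (circleMode n)) :
    A = B := by
  have : Fact (0 < (1 : ℝ)) := ⟨one_pos⟩
  let e : AddCircle (1 : ℝ) ≃ₜ Circle := AddCircle.homeomorphCircle one_ne_zero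
  let c : C(AddCircle (1 : ℝ), ℂ) →L[ℂ] L2Circle :=
    (ContinuousMap.toLp 2 circleHaar ℂ).comp
      (ContinuousMap.compCLM ℂ ℂ (e.symm : C(Circle, AddCircle (1 : ℝ))))
  have hc (n : ℤ) : c (fourier n) = circleMode n := by
    refine congrArg (ContinuousMap.toLp 2 circleHaar ℂ) (ContinuousMap.ext fun z => ?_)
    change ((AddCircle.toCircle (n • e.symm z) : Circle) : ℂ) = ((z ^ n : Circle) : ℂ)
    rw [AddCircle.toCircle_zsmul, ← AddCircle.homeomorphCircle_apply one_ne_zero,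
      Homeomorph.apply_symm_apply]
  have hdense : Dense (Submodule.span ℂ (Set.range (@fourier (1 : ℝ))) : Set C(AddCircle (1 : ℝ), ℂ)) :=
    Submodule.dense_iff_topologicalClosure_eq_top.2 span_fourier_closure_eq_top
  have hAB : A.comp c = B.comp c := by
    refine ContinuousLinearMap.ext_on hdense ?_
    rintro _ ⟨n, rfl⟩
    simp only [ContinuousLinearMap.comp_apply, hc, h]
  refine DFunLike.coe_injective ((ContinuousMap.toLp_denseRange ℂ circleHaar ℂ
    ENNReal.ofNat_ne_top).equalizer A.continuous B.continuous (funext fun f => ?_))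
  have hf := congrArg (fun T => T (f.comp (e : C(AddCircle (1 : ℝ), Circle)))) hAB
  have hcf : c (f.comp (e : C(AddCircle (1 : ℝ), Circle))) = ContinuousMap.toLp 2 circleHaar ℂ f := by
    refine congrArg (ContinuousMap.toLp 2 circleHaar ℂ) (ContinuousMap.ext fun z => ?_)
    exact congrArg f (e.apply_symm_apply z)
  simp only [ContinuousLinearMap.comp_apply, hcf] at hf
  exact hf

lemma isCuntzRepresentation_cantorFilter :
    IsCuntzRepresentation (fun i : Fin 3 => filterOperator 3 (cantorFilter i)) where
  orthogonality := adjoint_comp_filterOperator_cantorFilter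
  completeness := by
    set P := ∑ i : Fin 3, (filterOperator 3 (cantorFilter i)).comp
      (ContinuousLinearMap.adjoint (filterOperator 3 (cantorFilter i))) with hP
    have hS (j : Fin 3) (f : L2Circle) :
        P (filterOperator 3 (cantorFilter j) f) = filterOperator 3 (cantorFilter j) f := by
      have h (i : Fin 3) : ContinuousLinearMap.adjoint (filterOperator 3 (cantorFilter i))
          (filterOperator 3 (cantorFilter j) f) = if i = j then f else 0 := by
        rw [← ContinuousLinearMap.comp_apply, adjoint_comp_filterOperator_cantorFilter]
        split_ifs <;> rfl
      simp only [hP, sum_apply, ContinuousLinearMap.comp_apply, h]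
      rw [Finset.sum_eq_single j (fun i _ hi => by rw [if_neg hi, map_zero]) (by simp), if_pos rfl]
    refine ext_circleMode fun n => ?_
    rw [ContinuousLinearMap.id_apply]
    obtain ⟨k, rfl | rfl | rfl⟩ : ∃ k, n = 3 * k ∨ n = 3 * k + 1 ∨ n = 3 * k + 2 :=
      ⟨n / 3, by omega⟩
    · rw [circleMode_three_mul, map_smul, map_add, hS, hS]
    · rw [circleMode_three_mul_add_one, hS]
    · rw [circleMode_three_mul_add_two, map_smul, map_sub, hS, hS]

section words

variable {H : Type*} [NormedAddCommGroup H] [InnerProductSpace ℂ H] [CompleteSpace H] {N : ℕ}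
  (S : Fin N → H →L[ℂ] H)

lemma adjointWord_succ {k : ℕ} (i : Fin (k + 1) → Fin N) (v : H) :
    adjointWord S i v =
      adjointWord S (fun j => i j.succ) (ContinuousLinearMap.adjoint (S (i 0)) v) := by
  simp only [adjointWord, List.ofFn_succ, List.foldl_cons]

lemma adjointWord_smul {k : ℕ} (i : Fin k → Fin N) (c : ℂ) (v : H) :
    adjointWord S i (c • v) = c • adjointWord S i v := by
  induction k generalizing v with
  | zero => simp [adjointWord]
  | succ k ih => rw [adjointWord_succ, adjointWord_succ, map_smul, ih]

end words

lemma circleMode_zero_eq : circleMode 0 = ((Real.sqrt 2 : ℝ) : ℂ)⁻¹ •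
    (filterOperator 3 (cantorFilter 0) (circleMode 0) +
      filterOperator 3 (cantorFilter 2) (circleMode 0)) := by
  simpa only [mul_zero] using circleMode_three_mul 0

lemma adjoint_filterOperator_circleMode_zero (d : Fin 3) :
    ContinuousLinearMap.adjoint (filterOperator 3 (cantorFilter d)) (circleMode 0) =
      (if d = 1 then 0 else ((Real.sqrt 2 : ℝ) : ℂ)⁻¹) • circleMode 0 := by
  have h (j : Fin 3) : ContinuousLinearMap.adjoint (filterOperator 3 (cantorFilter d))
      (filterOperator 3 (cantorFilter j) (circleMode 0)) = if d = j then circleMode 0 else 0 := by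
    rw [← ContinuousLinearMap.comp_apply, adjoint_comp_filterOperator_cantorFilter]
    split_ifs <;> rfl
  conv_lhs => rw [circleMode_zero_eq]
  rw [map_smul, map_add, h, h]
  rcases (by fin_cases d <;> simp : d = 0 ∨ d = 1 ∨ d = 2) with rfl | rfl | rfl <;> simp

lemma norm_circleMode (n : ℤ) : ‖circleMode n‖ = 1 := by
  have h : ‖circleMode n‖ ^ 2 = 1 := by
    rw [← inner_self_eq_norm_sq (𝕜 := ℂ), L2.inner_def, integral_congr_ae (g := fun _ => (1 : ℂ))]
    · simp
    · filter_upwards [coeFn_circleMode n] with z hz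
      rw [hz, inner_self_eq_norm_sq_to_K, Circle.norm_coe]
      simp
  exact (pow_eq_one_iff_of_nonneg (norm_nonneg _) two_ne_zero).1 h

lemma norm_adjointWord_circleMode_zero_sq {k : ℕ} (i : Fin k → Fin 3) :
    ‖adjointWord (fun i : Fin 3 => filterOperator 3 (cantorFilter i)) i (circleMode 0)‖ ^ 2 =
      cantorWeight i := by
  induction k with
  | zero => simp [adjointWord, cantorWeight, norm_circleMode]
  | succ k ih =>
    rw [adjointWord_succ, adjoint_filterOperator_circleMode_zero, adjointWord_smul, norm_smul,
      mul_pow, ih, cantorWeight_succ]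
    congr 1
    split_ifs
    · simp
    · rw [norm_inv, Complex.norm_real, Real.norm_of_nonneg (Real.sqrt_nonneg _), inv_pow,
        Real.sq_sqrt (by norm_num), one_div]

/-- The Hausdorff measure on the Cantor set is the measure induced by the Cantor filters. -/
lemma isAdicMeasure_hausdorffMeasure_restrict :
    IsAdicMeasure (fun i : Fin 3 => filterOperator 3 (cantorFilter i)) (circleMode 0)
      ((Measure.hausdorffMeasure cantorDim).restrict cantorSet) where
  carrier := by
    rw [Measure.restrict_apply measurableSet_Icc.compl]
    refine measure_mono_null (t := ∅) ?_ measure_empty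
    exact fun x hx => hx.1 (cantorSet_subset_unitInterval hx.2)
  mass := by
    rw [Measure.restrict_apply_univ, hausdorffMeasure_cantorSet, norm_circleMode]
    simp
  interval k i := by
    rw [Measure.restrict_apply measurableSet_Ico, Set.inter_comm,
      norm_adjointWord_circleMode_zero_sq, ← hausdorffMeasure_cantorSet_inter_Ico]
    norm_cast

theorem proposition4p2 :
    (∀ z : Circle, filterMatrix 3 cantorFilter z ∈ Matrix.unitaryGroup (Fin 3) ℂ) ∧
    IsCuntzRepresentation (fun i : Fin 3 => filterOperator 3 (cantorFilter i)) ∧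
    (∀ μ : Measure ℝ,
      IsAdicMeasure (fun i : Fin 3 => filterOperator 3 (cantorFilter i)) (circleMode 0) μ ↔
        μ = (Measure.hausdorffMeasure (Real.log 2 / Real.log 3)).restrict cantorSet) ∧
    Measure.hausdorffMeasure (Real.log 2 / Real.log 3) cantorSet = 1 := by
  refine ⟨filterMatrix_cantorFilter_mem_unitaryGroup, isCuntzRepresentation_cantorFilter,
    fun μ => ⟨fun hμ => ?_, ?_⟩, hausdorffMeasure_cantorSet⟩
  · exact hμ.unique (by norm_num) isAdicMeasure_hausdorffMeasure_restrict
  · rintro rfl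
    exact isAdicMeasure_hausdorffMeasure_restrict
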